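/- **Theorem (Wall-crossing formula for triangulated categories).** Let $k$ be a finite field and let $\mathcal D$ be a $k$-linear triangulated category (with $k$-linear shift) which is Krull–Schmidt (every object is a finite direct sum of objects with local endomorphism rings) and left homologically finite ($\sum_{i\ge 0}\dim_k\mathrm{Hom}(X[i],Y)<\infty$ for all $X,Y$). Let $\sigma=(Z,\mathcal P)$ be a Bridgeland stability condition on $\mathcal D$, with central charge $Z:K_0(\mathcal D)\to\mathbb C$ and slices $\mathcal P(\phi)$, $\phi\in\mathbb R$. For objects $L,M,N$ let $(L,N)_{M[1]}$ be the set of morphisms $L\to N$ with cone isomorphic to $M[1]$, let $\{L,N\}=\prod_{i>0}|\mathrm{Hom}(L[i],N)|^{(-1)^i}$, and let $$F_{MN}^L=\frac{|(L,N)_{M[1]}|}{|\mathrm{Aut}\,N|}\cdot\frac{\{L,N\}}{\{N,N\}}$$ be the structure constants $u_{[M]}*u_{[N]}=\sum_{[L]}F_{MN}^L\,u_{[L]}$ of the Xiao–Xu derived Hall algebra $\mathcal H(\mathcal D)$. In the completion of $\mathcal H(\mathcal D)$ consisting of all functions $f$ from isomorphism classes of objects to $\mathbb Q$ (regarded as formal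 sums $\sum_{[M]} f([M])u_{[M]}$), the product is given by the same formula, $$(f*g)([L])=\sum_{[M],[N]}f([M])\,g([N])\,F_{MN}^L,$$ and is defined when, for each $L$, only finitely many terms are nonzero. Let $1_{\mathcal D}$ be the function with value $1$ on every isomorphism class, and let $\mathrm{SS}^\sigma_\phi$ be the characteristic function of $\mathcal P(\phi)$ (so its value at the zero object is $1$). Then $$1_{\mathcal D}=\prod^{\leftarrow}_{\phi\in\mathbb R}\mathrm{SS}^\sigma_\phi .$$ This means: for every finite set $F=\{\phi_1>\dots>\phi_n\}\subset\mathbb R$ the descending product $\mathrm{SS}^\sigma_{\phi_1}*\cdots*\mathrm{SS}^\sigma_{\phi_n}$ is defined and independent of the bracketing (for $F=\emptyset$ it is $u_{[0]}$), and for each object $X$ its value at $[X]$ equals $1_{\mathcal D}([X])=1$ for all sufficiently large finite sets $F$ (that is, all those containing some finite set depending on $X$). -/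

import Mathlib

open CategoryTheory CategoryTheory.Limits CategoryTheory.Pretriangulated Filter
open scoped ZeroObject

noncomputable section

namespace DerivedHall

universe v u w

set_option linter.unusedSectionVars false

/-! ## Krull-Schmidt and homological finiteness -/

/-- A category with finite biproducts is Krull-Schmidt if every object is a finite direct sum of
objects whose endomorphism rings are local. -/
def IsKrullSchmidt (D : Type u) [Category.{v} D] [Preadditive D] [HasFiniteBiproducts D] : Prop :=
  ∀ X : D, ∃ (n : ℕ) (Y : Fin n → D),
    (∀ i, IsLocalRing (End (Y i))) ∧ Nonempty (X ≅ ⨁ Y)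

/-- Left homological finiteness over `k`: for all `X`, `Y` the sum over `i ≥ 0` of the
`k`-dimensions of `Hom(X[i], Y)` is finite, that is, every term is finite and all but finitely
many terms vanish. -/
def IsLeftHomologicallyFinite (k : Type w) [Field k] (D : Type u) [Category.{v} D] [Preadditive D]
    [Linear k D] [HasShift D ℤ] : Prop :=
  ∀ X Y : D, (∀ i : ℕ, Module.Finite k (X⟦(i : ℤ)⟧ ⟶ Y)) ∧
    {i : ℕ | Nontrivial (X⟦(i : ℤ)⟧ ⟶ Y)}.Finite

section Triangulated

variable (D : Type u) [Category.{v} D] [HasZeroObject D] [HasShift D ℤ] [Preadditive D]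
  [∀ n : ℤ, (shiftFunctor D n).Additive] [Pretriangulated D]

/-! ## The Grothendieck group and stability conditions -/

/-- The subgroup of relations `[T₂] = [T₁] + [T₃]`, one for each distinguished triangle
`T₁ ⟶ T₂ ⟶ T₃ ⟶ T₁[1]`. -/
def triangleRelations : AddSubgroup (FreeAbelianGroup D) :=
  AddSubgroup.closure {x | ∃ T ∈ distTriang D,
    x = FreeAbelianGroup.of T.obj₂ - FreeAbelianGroup.of T.obj₁ - FreeAbelianGroup.of T.obj₃}

/-- The Grothendieck group of a triangulated category. -/
abbrev K₀ : Type u := FreeAbelianGroup D ⧸ triangleRelations D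

variable {D}

/-- The class of an object in the Grothendieck group. -/
def classOf (X : D) : K₀ D := QuotientAddGroup.mk (FreeAbelianGroup.of X)

/-- A filtration of `M` with factors in the subcategories `P φ`, of strictly decreasing phases:
a chain `0 = E₀ ⟶ E₁ ⟶ ⋯ ⟶ Eₙ = M` and distinguished triangles
`Eᵢ ⟶ Eᵢ₊₁ ⟶ Aᵢ ⟶ Eᵢ[1]` with `Aᵢ` in `P φᵢ` and `φ₀ > φ₁ > ⋯ > φₙ₋₁`. -/
def HasHNFiltration (P : ℝ → ObjectProperty D) (M : D) : Prop :=
  ∃ (n : ℕ) (E : Fin (n + 1) → D) (A : Fin n → D) (φ : Fin n → ℝ),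
    IsZero (E 0) ∧ Nonempty (E (Fin.last n) ≅ M) ∧ StrictAnti φ ∧
    ∀ i : Fin n, P (φ i) (A i) ∧
      ∃ (f : E i.castSucc ⟶ E i.succ) (g : E i.succ ⟶ A i) (h : A i ⟶ (E i.castSucc)⟦(1 : ℤ)⟧),
        Triangle.mk f g h ∈ distTriang D

variable (D) in
/-- A Bridgeland stability condition `(Z, P)`: a central charge and a slicing. -/
structure StabilityCondition where
  /-- The central charge. -/
  Z : K₀ D →+ ℂ
  /-- The slices, as full subcategories. -/
  P : ℝ → ObjectProperty D
  /-- Slices are closed under isomorphism. -/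
  iso_mem : ∀ (φ : ℝ) (X Y : D), (X ≅ Y) → P φ X → P φ Y
  /-- Slices contain the zero objects. -/
  zero_mem : ∀ (φ : ℝ) (X : D), IsZero X → P φ X
  /-- Slices are closed under direct sums. -/
  sum_mem : ∀ (φ : ℝ) (X Y : D), P φ X → P φ Y → P φ (X ⊞ Y)
  /-- Slices are closed under extensions. -/
  ext_mem : ∀ (φ : ℝ), ∀ T ∈ distTriang D, P φ T.obj₁ → P φ T.obj₃ → P φ T.obj₂
  /-- A nonzero object of `P φ` has central charge on the ray of phase `φ`. -/
  charge : ∀ (φ : ℝ) (X : D), P φ X → ¬ IsZero X →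
    ∃ m : ℝ, 0 < m ∧ Z (classOf X) = m * Complex.exp (Complex.I * Real.pi * φ)
  /-- `P (φ + 1) = P φ [1]`. -/
  shift : ∀ (φ : ℝ) (X : D), P (φ + 1) X ↔ ∃ Y, P φ Y ∧ Nonempty (X ≅ Y⟦(1 : ℤ)⟧)
  /-- There are no nonzero morphisms from higher to lower phase. -/
  hom_eq_zero : ∀ (φ₁ φ₂ : ℝ) (A₁ A₂ : D), φ₂ < φ₁ → P φ₁ A₁ → P φ₂ A₂ →
    ∀ f : A₁ ⟶ A₂, f = 0
  /-- Every nonzero object has a Harder-Narasimhan filtration. -/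
  filtration : ∀ M : D, ¬ IsZero M → HasHNFiltration P M

/-! ## Derived Hall numbers -/

/-- The set `(L, N)_C` of morphisms `L ⟶ N` with cone isomorphic to `C`. -/
def homWithCone (L N C : D) : Set (L ⟶ N) :=
  {f | ∃ (g : N ⟶ C) (h : C ⟶ L⟦(1 : ℤ)⟧), Triangle.mk f g h ∈ distTriang D}

/-- The alternating product `{L, N} = ∏_{i > 0} |Hom(L[i], N)| ^ ((-1) ^ i)`. -/
def braces (L N : D) : ℚ :=
  ∏ᶠ (i : ℕ) (_ : 0 < i), (Nat.card (L⟦(i : ℤ)⟧ ⟶ N) : ℚ) ^ ((-1 : ℤ) ^ i)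

/-- The derived Hall number
`F_{MN}^L = (|(L, N)_{M[1]}| / |Aut N|) * ({L, N} / {N, N})`. -/
def hallNumber (M N L : D) : ℚ :=
  (Nat.card (homWithCone L N (M⟦(1 : ℤ)⟧)) : ℚ) / (Nat.card (Aut N) : ℚ) *
    (braces L N / braces N N)

/-! ## Invariance under isomorphism -/

lemma homWithCone_of_iso {L L' N N' C C' : D} (a : L ≅ L') (b : N ≅ N') (c : C ≅ C')
    {f : L ⟶ N} (hf : f ∈ homWithCone L N C) :
    a.inv ≫ f ≫ b.hom ∈ homWithCone L' N' C' := by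
  obtain ⟨g, h, hT⟩ := hf
  refine ⟨b.inv ≫ g ≫ c.hom, c.inv ≫ h ≫ a.hom⟦(1 : ℤ)⟧', ?_⟩
  refine isomorphic_distinguished _ hT _ (Triangle.isoMk _ _ a.symm b.symm c.symm ?_ ?_ ?_)
  · change (a.inv ≫ f ≫ b.hom) ≫ b.inv = a.inv ≫ f
    simp only [Category.assoc, Iso.hom_inv_id, Category.comp_id]
  · change (b.inv ≫ g ≫ c.hom) ≫ c.inv = b.inv ≫ g
    simp only [Category.assoc, Iso.hom_inv_id, Category.comp_id]
  · change (c.inv ≫ h ≫ a.hom⟦(1 : ℤ)⟧') ≫ a.inv⟦(1 : ℤ)⟧' = c.inv ≫ h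
    rw [Category.assoc, Category.assoc, ← Functor.map_comp, Iso.hom_inv_id,
      CategoryTheory.Functor.map_id, Category.comp_id]

lemma card_homWithCone_congr {L L' N N' C C' : D} (a : L ≅ L') (b : N ≅ N') (c : C ≅ C') :
    Nat.card (homWithCone L N C) = Nat.card (homWithCone L' N' C') := by
  refine Nat.card_congr (Equiv.subtypeEquiv (a.homCongr b) fun f => ⟨fun hf => ?_, fun hf => ?_⟩)
  · simpa [Iso.homCongr] using homWithCone_of_iso a b c hf
  · simpa [Iso.homCongr] using homWithCone_of_iso a.symm b.symm c.symm hf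

lemma braces_congr {L L' N N' : D} (a : L ≅ L') (b : N ≅ N') : braces L N = braces L' N' := by
  unfold braces
  refine finprod_congr fun i => ?_
  rw [Nat.card_congr (((shiftFunctor D (i : ℤ)).mapIso a).homCongr b)]

lemma hallNumber_congr {M M' N N' L L' : D} (a : M ≅ M') (b : N ≅ N') (c : L ≅ L') :
    hallNumber M N L = hallNumber M' N' L' := by
  unfold hallNumber
  rw [card_homWithCone_congr c b ((shiftFunctor D (1 : ℤ)).mapIso a), braces_congr c b,
    braces_congr b b, Nat.card_congr (Aut.autMulEquivOfIso b).toEquiv]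

/-! ## The completed derived Hall algebra -/

variable (D) in
/-- The set of isomorphism classes of objects. -/
abbrev IsoClass : Type u := Quotient (isIsomorphicSetoid D)

/-- The isomorphism class of an object. -/
abbrev isoClass (X : D) : IsoClass D := Quotient.mk (isIsomorphicSetoid D) X

/-- The derived Hall number on isomorphism classes. -/
def hallCoeff (M N L : IsoClass D) : ℚ :=
  letI := isIsomorphicSetoid D
  Quotient.liftOn₂ M N
    (fun M N => Quotient.liftOn L (fun L => hallNumber M N L)
      fun _ _ h => h.elim fun c => hallNumber_congr (Iso.refl _) (Iso.refl _) c)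
    fun M N M' N' hM hN => hM.elim fun a => hN.elim fun b => by
      induction L using Quotient.inductionOn with
      | h L => exact hallNumber_congr a b (Iso.refl _)

variable (D) in
/-- All rational functions on isomorphism classes of objects. A function `f` stands for the formal
sum `∑ f [M] u_[M]`; the finitely supported functions form the derived Hall algebra. Isomorphism
classes being partitioned by their classes `γ` in `K₀ D`, this is the product over `γ` of the
spaces of all functions on the isomorphism classes of class `γ`. -/
abbrev HallFunction : Type u := IsoClass D → ℚ

/-- `h` is the Hall product `f * g`, i.e. the bilinear extension
`∑ f [M] g [N] F_{MN}^L u_[L]` of `u_[M] * u_[N] = ∑ F_{MN}^L u_[L]`: the sum giving each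
coefficient has only finitely many nonzero terms, and its value is the coefficient of `h`. -/
def HasHallProduct (f g h : HallFunction D) : Prop :=
  ∀ L : IsoClass D,
    (Function.support fun p : IsoClass D × IsoClass D =>
      f p.1 * g p.2 * hallCoeff p.1 p.2 L).Finite ∧
    ∑ᶠ p : IsoClass D × IsoClass D, f p.1 * g p.2 * hallCoeff p.1 p.2 L = h L

open scoped Classical in
/-- The basis element `u_[M]`. -/
def basisElement (M : IsoClass D) : HallFunction D := Pi.single M 1

variable (D) in
/-- The unit `u_[0]`. -/
def hallOne : HallFunction D := basisElement (isoClass (0 : D))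

/-- On basis elements, the product is the one with structure constants the Hall numbers. -/
lemma hasHallProduct_basisElement (M N : IsoClass D) :
    HasHallProduct (basisElement M) (basisElement N) (hallCoeff M N) := by
  classical
  intro L
  have h : ∀ p : IsoClass D × IsoClass D, p ≠ (M, N) →
      basisElement M p.1 * basisElement N p.2 * hallCoeff p.1 p.2 L = 0 := by
    rintro ⟨a, b⟩ hp
    by_cases ha : a = M
    · have hb : b ≠ N := fun hb => hp (by rw [ha, hb])
      simp [basisElement, hb]
    · simp [basisElement, ha]
  refine ⟨(Set.finite_singleton (M, N)).subset fun p hp => ?_, ?_⟩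
  · by_contra hne
    exact hp (h p hne)
  · rw [finsum_eq_single _ (M, N) h]
    simp [basisElement]

variable (D) in
/-- The function `1_D`, with value `1` on every isomorphism class. -/
def allOnes : HallFunction D := fun _ => 1

open scoped Classical in
/-- The function `SS_φ`: the characteristic function of the slice `P φ`. As `P φ` contains the zero
objects, its value at `0` is `1`. -/
def semistableFunction (σ : StabilityCondition D) (φ : ℝ) : HallFunction D :=
  letI := isIsomorphicSetoid D
  Quotient.lift (fun X : D => if σ.P φ X then (1 : ℚ) else 0) fun X Y h => h.elim fun e => by
    simp only [show σ.P φ X ↔ σ.P φ Y from ⟨σ.iso_mem φ X Y e, σ.iso_mem φ Y X e.symm⟩]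

/-- `p F` is, for every finite set `F = {φ₁ > ⋯ > φₙ}` of reals, the product
`s φ₁ * ⋯ * s φₙ` in descending order. The empty product is the unit, the product over a singleton
is the factor itself, and splitting `F` into an upper part and a lower part at any place
(so for any bracketing) the product over `F` is the product of the two partial products. These
properties determine `p`. -/
structure IsDescendingFinProd (s : ℝ → HallFunction D) (p : Finset ℝ → HallFunction D) : Prop where
  empty : p ∅ = hallOne D
  singleton : ∀ φ, p {φ} = s φ
  union : ∀ F G : Finset ℝ, (∀ a ∈ F, ∀ b ∈ G, b < a) → HasHallProduct (p F) (p G) (p (F ∪ G))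

/-- `f` is the descending product `∏ s φ` over all real `φ`: the finite descending products are
defined, and along the directed set of finite sets of reals each of their coefficients is
eventually constant, equal to the coefficient of `f`. -/
def HasDescendingProd (s : ℝ → HallFunction D) (f : HallFunction D) : Prop :=
  ∃ p : Finset ℝ → HallFunction D, IsDescendingFinProd s p ∧
    ∀ X : IsoClass D, ∀ᶠ F in atTop, p F X = f X

end Triangulated
end DerivedHall

end

noncomputable section

namespace DerivedHall

universe v u w

set_option linter.unusedSectionVars false

section Triangulated

variable {D : Type u} [Category.{v} D] [HasZeroObject D] [HasShift D ℤ] [Preadditive D]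
  [∀ n : ℤ, (shiftFunctor D n).Additive] [Pretriangulated D]

/-! Let `M ⟶ L ⟶ N ⟶ M[1]` be distinguished with `Hom(M[i], N) = 0` for all `i ≥ 0`. By the long
exact sequence, `Hom(N[i], N) ≅ Hom(L[i], N)`, so `{L, N} = {N, N}`, and the morphisms `L ⟶ N` with
cone `M[1]` form one free orbit of `Aut N`. Hence the Hall number is 1 (`hallNumber_eq_one`). If
such vanishing holds between all of `A` and all of `B`, then `L` also determines `M` and `N` up to
isomorphism, so the product of the characteristic functions of `A` and `B` is that of the class of
extensions `star A B` (`hasHallProduct_charFun`).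

Slices of decreasing phase satisfy the vanishing, because shifting by `i ≥ 0` only raises the phase.
A finite descending product is therefore the characteristic function of an iterated extension class,
and the octahedral axiom (`star_assoc`) makes the bracketing irrelevant. Each object has finitely
many Harder-Narasimhan phases, and any finite set containing them gives the value 1. -/

/-! ## Extensions of one class of objects by another -/

/-- The objects `L` in a distinguished triangle `M ⟶ L ⟶ N ⟶ M[1]` with `M` in `A` and
`N` in `B`. -/
def star (A B : ObjectProperty D) : ObjectProperty D := fun L =>
  ∃ (M N : D) (f : M ⟶ L) (g : L ⟶ N) (h : N ⟶ M⟦(1 : ℤ)⟧),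
    A M ∧ B N ∧ Triangle.mk f g h ∈ distTriang D

lemma star_of_iso {A B : ObjectProperty D} {L L' : D} (e : L ≅ L') (hL : star A B L) :
    star A B L' := by
  obtain ⟨M, N, f, g, h, hM, hN, hT⟩ := hL
  refine ⟨M, N, f ≫ e.hom, e.inv ≫ g, h, hM, hN, isomorphic_distinguished _ hT _
    (Triangle.isoMk _ _ (Iso.refl _) e.symm (Iso.refl _) ?_ ?_ ?_)⟩
  · change (f ≫ e.hom) ≫ e.inv = 𝟙 M ≫ f
    simp
  · change (e.inv ≫ g) ≫ 𝟙 N = e.inv ≫ g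
    simp
  · change h ≫ (𝟙 M)⟦(1 : ℤ)⟧' = 𝟙 N ≫ h
    simp

lemma star_of_isZero_left {A B : ObjectProperty D} {M N : D} (hM : IsZero M) (hAM : A M)
    (hN : B N) : star A B N :=
  ⟨M, N, 0, 𝟙 N, 0, hAM, hN, (Triangle.distinguished_iff_of_isZero₁ _ hM).2
    (inferInstanceAs (IsIso (𝟙 N)))⟩

lemma star_of_isZero_right {A B : ObjectProperty D} {M N : D} (hN : IsZero N) (hM : A M)
    (hBN : B N) : star A B M :=
  ⟨M, N, 𝟙 M, 0, 0, hM, hBN, (Triangle.distinguished_iff_of_isZero₃ _ hN).2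
    (inferInstanceAs (IsIso (𝟙 M)))⟩

lemma exists_iso_of_star_isZero_left {A B : ObjectProperty D} (hA : ∀ M, A M → IsZero M) {L : D}
    (hL : star A B L) : ∃ N, B N ∧ Nonempty (N ≅ L) := by
  obtain ⟨M, N, f, g, h, hM, hN, hT⟩ := hL
  have : IsIso g := (Triangle.isZero₁_iff_isIso₂ _ hT).1 (hA M hM)
  exact ⟨N, hN, ⟨(asIso g).symm⟩⟩

lemma exists_iso_of_star_isZero_right {A B : ObjectProperty D} (hB : ∀ N, B N → IsZero N) {L : D}
    (hL : star A B L) : ∃ M, A M ∧ Nonempty (M ≅ L) := by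
  obtain ⟨M, N, f, g, h, hM, hN, hT⟩ := hL
  have : IsIso f := (Triangle.isZero₃_iff_isIso₁ _ hT).1 (hB N hN)
  exact ⟨M, hM, ⟨asIso f⟩⟩

lemma star_mono {A A' B B' : ObjectProperty D} (hA : ∀ M, A M → A' M) (hB : ∀ N, B N → B' N)
    {L : D} (hL : star A B L) : star A' B' L := by
  obtain ⟨M, N, f, g, h, hM, hN, hT⟩ := hL
  exact ⟨M, N, f, g, h, hA M hM, hB N hN, hT⟩

/-- Octahedral axiom, applied to the composite `M ⟶ X ⟶ L` in one direction and to `L ⟶ W ⟶ N` in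
the other. -/
lemma star_assoc [IsTriangulated D] (A B C : ObjectProperty D) (L : D) :
    star (star A B) C L ↔ star A (star B C) L := by
  constructor
  · rintro ⟨X, N, f, g, h, ⟨M, Y, f', g', h', hM, hY, hT'⟩, hN, hT⟩
    obtain ⟨Z, v, w, hZ⟩ := distinguished_cocone_triangle (f' ≫ f)
    have o := Triangulated.someOctahedron rfl hT' hT hZ
    exact ⟨M, Z, _, v, w, hM, ⟨Y, N, _, _, _, hY, hN, o.mem⟩, hZ⟩
  · rintro ⟨M, W, f, g, h, hM, ⟨Y, N, f', g', h', hY, hN, hT'⟩, hT⟩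
    obtain ⟨Z, v, w, hZ⟩ := distinguished_cocone_triangle₁ (g ≫ g')
    have o := Triangulated.someOctahedron' rfl hT hT' hZ
    exact ⟨Z, N, v, _, w, ⟨M, Y, _, _, _, hM, hY, o.mem⟩, hN, hZ⟩

lemma mem_homWithCone_shift_iff {L M N : D} (g : L ⟶ N) :
    g ∈ homWithCone L N (M⟦(1 : ℤ)⟧) ↔
      ∃ (f : M ⟶ L) (h : N ⟶ M⟦(1 : ℤ)⟧), Triangle.mk f g h ∈ distTriang D := by
  constructor
  · rintro ⟨h, r, hT⟩
    obtain ⟨f, rfl⟩ := (shiftFunctor D (1 : ℤ)).map_surjective r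
    -- Rotation negates the shifted first morphism; the sign in `-f` cancels this.
    refine ⟨-f, h, (rotate_distinguished_triangle _).2 ?_⟩
    change Triangle.mk g h (-(-f)⟦(1 : ℤ)⟧') ∈ distTriang D
    rwa [Functor.map_neg, neg_neg]
  · rintro ⟨f, h, hT⟩
    exact ⟨h, _, rot_of_distTriang _ hT⟩

/-! ## Vanishing of morphisms in nonpositive degrees -/

/-- All morphisms from the nonnegative shifts of `M` to `N` vanish. -/
def NoHom (M N : D) : Prop := ∀ (i : ℕ) (f : M⟦(i : ℤ)⟧ ⟶ N), f = 0

lemma noHom_of_isZero_left {M : D} (hM : IsZero M) (N : D) : NoHom M N := fun i _ =>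
  ((shiftFunctor D (i : ℤ)).map_isZero hM).eq_of_src _ _

lemma noHom_of_isZero_right (M : D) {N : D} (hN : IsZero N) : NoHom M N := fun _ _ =>
  hN.eq_of_tgt _ _

lemma NoHom.of_triangle_left {X : D} {T : Triangle D} (hT : T ∈ distTriang D)
    (h₁ : NoHom T.obj₁ X) (h₃ : NoHom T.obj₃ X) : NoHom T.obj₂ X := fun i f => by
  have hT' := Triangle.shift_distinguished T hT (i : ℤ)
  obtain ⟨u, rfl⟩ := Triangle.yoneda_exact₂ _ hT' f (h₁ i _)
  exact (congrArg _ (h₃ i u)).trans comp_zero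

lemma NoHom.of_triangle_right {X : D} {T : Triangle D} (hT : T ∈ distTriang D)
    (h₁ : NoHom X T.obj₁) (h₃ : NoHom X T.obj₃) : NoHom X T.obj₂ := fun i f => by
  obtain ⟨u, rfl⟩ := Triangle.coyoneda_exact₂ _ hT f (h₃ i _)
  rw [h₁ i u, zero_comp]

lemma NoHom.star_left {A B : ObjectProperty D} {X : D} (hA : ∀ M, A M → NoHom M X)
    (hB : ∀ N, B N → NoHom N X) (L : D) (hL : star A B L) : NoHom L X := by
  obtain ⟨M, N, f, g, h, hM, hN, hT⟩ := hL
  exact NoHom.of_triangle_left hT (hA M hM) (hB N hN)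

lemma NoHom.star_right {A B : ObjectProperty D} {X : D} (hA : ∀ M, A M → NoHom X M)
    (hB : ∀ N, B N → NoHom X N) (L : D) (hL : star A B L) : NoHom X L := by
  obtain ⟨M, N, f, g, h, hM, hN, hT⟩ := hL
  exact NoHom.of_triangle_right hT (hA M hM) (hB N hN)

lemma NoHom.eq_zero {M N : D} (h : NoHom M N) (f : M ⟶ N) : f = 0 := by
  have e : M⟦((0 : ℕ) : ℤ)⟧ ≅ M := (shiftFunctorZero' D _ Nat.cast_zero).app M
  rw [← cancel_epi e.hom, h 0 (e.hom ≫ f), comp_zero]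

lemma NoHom.shift_shift_eq_zero {M N : D} (h : NoHom M N) (i : ℕ)
    (f : (M⟦(i : ℤ)⟧)⟦(1 : ℤ)⟧ ⟶ N) : f = 0 := by
  have e : M⟦((i + 1 : ℕ) : ℤ)⟧ ≅ (M⟦(i : ℤ)⟧)⟦(1 : ℤ)⟧ :=
    (shiftFunctorAdd' D (i : ℤ) 1 _ (Nat.cast_succ i).symm).app M
  rw [← cancel_epi e.hom, h (i + 1) (e.hom ≫ f), comp_zero]

lemma NoHom.shift_eq_zero {M N : D} (h : NoHom M N) (f : M⟦(1 : ℤ)⟧ ⟶ N) : f = 0 := by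
  have := h 1
  rw [Nat.cast_one] at this
  exact this f

/-- In the long exact sequence of `Hom(-, X)`, `h₀` gives surjectivity and `h₁` injectivity. -/
lemma bijective_precomp_mor₂ {T : Triangle D} (hT : T ∈ distTriang D) {X : D}
    (h₀ : ∀ f : T.obj₁ ⟶ X, f = 0) (h₁ : ∀ f : T.obj₁⟦(1 : ℤ)⟧ ⟶ X, f = 0) :
    Function.Bijective fun u : T.obj₃ ⟶ X => T.mor₂ ≫ u := by
  constructor
  · intro u v huv
    have : T.mor₂ ≫ (u - v) = 0 := by
      rw [Preadditive.comp_sub, sub_eq_zero]; exact huv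
    obtain ⟨w, hw⟩ := Triangle.yoneda_exact₃ T hT _ this
    rw [h₁ w, comp_zero] at hw
    exact sub_eq_zero.1 hw
  · intro f
    obtain ⟨u, hu⟩ := Triangle.yoneda_exact₂ T hT f (h₀ _)
    exact ⟨u, hu.symm⟩

section

variable {M L N : D} {f : M ⟶ L} {g : L ⟶ N} {h : N ⟶ M⟦(1 : ℤ)⟧}

lemma NoHom.bijective_precomp (hT : Triangle.mk f g h ∈ distTriang D) {X : D} (hMX : NoHom M X) :
    Function.Bijective fun u : N ⟶ X => g ≫ u :=
  bijective_precomp_mor₂ hT hMX.eq_zero hMX.shift_eq_zero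

lemma NoHom.card_shift_hom (hT : Triangle.mk f g h ∈ distTriang D) {X : D} (hMX : NoHom M X)
    (i : ℕ) : Nat.card (L⟦(i : ℤ)⟧ ⟶ X) = Nat.card (N⟦(i : ℤ)⟧ ⟶ X) :=
  (Nat.card_congr (Equiv.ofBijective _ (bijective_precomp_mor₂
    (Triangle.shift_distinguished _ hT (i : ℤ)) (hMX i) (hMX.shift_shift_eq_zero i)))).symm

lemma NoHom.braces_eq (hT : Triangle.mk f g h ∈ distTriang D) {X : D} (hMX : NoHom M X) :
    braces L X = braces N X := by
  unfold braces
  refine finprod_congr fun i => ?_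
  rw [hMX.card_shift_hom hT i]

/-- Two triangles on the same middle object, with no morphisms from the nonnegative shifts of
either first object to either third object, have isomorphic third objects under the middle. -/
lemma NoHom.exists_iso_third (hT : Triangle.mk f g h ∈ distTriang D) {M' N' : D} {f' : M' ⟶ L}
    {g' : L ⟶ N'} {h' : N' ⟶ M'⟦(1 : ℤ)⟧} (hT' : Triangle.mk f' g' h' ∈ distTriang D)
    (h₁ : NoHom M N) (h₂ : NoHom M N') (h₃ : NoHom M' N) (h₄ : NoHom M' N') :
    ∃ e : N ≅ N', g ≫ e.hom = g' := by
  -- `g` and `g'` factor through each other; uniqueness of factorizations makes the two factors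
  -- mutually inverse.
  obtain ⟨u, hu⟩ := (h₂.bijective_precomp hT).2 g'
  obtain ⟨v, hv⟩ := (h₃.bijective_precomp hT').2 g
  dsimp only at hu hv
  refine ⟨⟨u, v, (h₁.bijective_precomp hT).1 ?_, (h₄.bijective_precomp hT').1 ?_⟩, hu⟩
  · dsimp only
    rw [reassoc_of% hu, hv, Category.comp_id]
  · dsimp only
    rw [reassoc_of% hv, hu, Category.comp_id]

/-- The isomorphism of third objects extends to one of the rotated triangles, giving `M[1] ≅ M'[1]`;
the shift is fully faithful. -/
lemma NoHom.nonempty_iso_first (hT : Triangle.mk f g h ∈ distTriang D) {M' N' : D} {f' : M' ⟶ L}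
    {g' : L ⟶ N'} {h' : N' ⟶ M'⟦(1 : ℤ)⟧} (hT' : Triangle.mk f' g' h' ∈ distTriang D)
    (h₁ : NoHom M N) (h₂ : NoHom M N') (h₃ : NoHom M' N) (h₄ : NoHom M' N') :
    Nonempty (M ≅ M') := by
  obtain ⟨e, he⟩ := exists_iso_third hT hT' h₁ h₂ h₃ h₄
  obtain ⟨i, -⟩ := exists_iso_of_arrow_iso _ _ (rot_of_distTriang _ hT)
    (rot_of_distTriang _ hT') (Arrow.isoMk (Iso.refl L) e ((Category.id_comp g').trans he.symm))
  exact ⟨(shiftFunctor D (1 : ℤ)).preimageIso (Triangle.π₃.mapIso i)⟩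

/-- `Aut N` acts by postcomposition, freely by injectivity of precomposition with `g` and
transitively by `exists_iso_third`. -/
lemma NoHom.card_homWithCone (hT : Triangle.mk f g h ∈ distTriang D) (hMN : NoHom M N) :
    Nat.card (homWithCone L N (M⟦(1 : ℤ)⟧)) = Nat.card (Aut N) := by
  have hg : g ∈ homWithCone L N (M⟦(1 : ℤ)⟧) := (mem_homWithCone_shift_iff g).2 ⟨f, h, hT⟩
  refine (Nat.card_congr (Equiv.ofBijective (fun u : Aut N =>
    (⟨g ≫ u.hom, by simpa using homWithCone_of_iso (Iso.refl L) u (Iso.refl _) hg⟩ :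
      homWithCone L N (M⟦(1 : ℤ)⟧))) ⟨fun u v huv => ?_, fun g' => ?_⟩)).symm
  · exact Iso.ext ((hMN.bijective_precomp hT).1 (Subtype.ext_iff.1 huv))
  · obtain ⟨f', h', hT'⟩ := (mem_homWithCone_shift_iff _).1 g'.2
    obtain ⟨e, he⟩ := exists_iso_third hT hT' hMN hMN hMN hMN
    exact ⟨e, Subtype.ext he⟩

end

/-! ## Finiteness of morphism spaces -/

lemma finite_shift_hom {k : Type w} [Field k] [Finite k] [Linear k D]
    (hfin : IsLeftHomologicallyFinite k D) (X Y : D) (i : ℕ) : Finite (X⟦(i : ℤ)⟧ ⟶ Y) :=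
  have := (hfin X Y).1 i
  Module.finite_of_finite k

lemma finite_aut {k : Type w} [Field k] [Finite k] [Linear k D]
    (hfin : IsLeftHomologicallyFinite k D) (X : D) : Finite (Aut X) := by
  have := finite_shift_hom hfin X X 0
  have e : X⟦((0 : ℕ) : ℤ)⟧ ≅ X := (shiftFunctorZero' D _ Nat.cast_zero).app X
  exact Finite.of_injective (fun u : Aut X => e.hom ≫ u.hom) fun u v huv =>
    Iso.ext ((cancel_epi e.hom).1 huv)

/-- Finiteness of the Hom spaces matters: `Nat.card` of an infinite type is 0. -/
lemma braces_ne_zero {k : Type w} [Field k] [Finite k] [Linear k D]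
    (hfin : IsLeftHomologicallyFinite k D) (X Y : D) : braces X Y ≠ 0 := by
  have (i : ℕ) := finite_shift_hom hfin X Y i
  refine finprod_induction (p := (· ≠ 0)) one_ne_zero (fun _ _ => mul_ne_zero) fun i =>
    finprod_induction (p := (· ≠ 0)) one_ne_zero (fun _ _ => mul_ne_zero) fun _ => ?_
  exact zpow_ne_zero _ (Nat.cast_ne_zero.2 Nat.card_pos.ne')

lemma hallNumber_eq_one {k : Type w} [Field k] [Finite k] [Linear k D]
    (hfin : IsLeftHomologicallyFinite k D) {M L N : D} {f : M ⟶ L} {g : L ⟶ N}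
    {h : N ⟶ M⟦(1 : ℤ)⟧} (hT : Triangle.mk f g h ∈ distTriang D) (hMN : NoHom M N) :
    hallNumber M N L = 1 := by
  have := finite_aut hfin N
  have : Nonempty (Aut N) := ⟨1⟩
  rw [hallNumber, hMN.card_homWithCone hT, hMN.braces_eq hT, div_self (braces_ne_zero hfin N N),
    div_self (Nat.cast_ne_zero.2 Nat.card_pos.ne'), one_mul]

lemma exists_triangle_of_hallNumber_ne_zero {M N L : D} (hne : hallNumber M N L ≠ 0) :
    ∃ (f : M ⟶ L) (g : L ⟶ N) (h : N ⟶ M⟦(1 : ℤ)⟧), Triangle.mk f g h ∈ distTriang D := by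
  have : Nonempty (homWithCone L N (M⟦(1 : ℤ)⟧)) := by
    by_contra hempty
    rw [not_nonempty_iff] at hempty
    exact hne (by simp [hallNumber])
  obtain ⟨g, hg⟩ := this
  obtain ⟨f, h, hT⟩ := (mem_homWithCone_shift_iff g).1 hg
  exact ⟨f, g, h, hT⟩

/-! ## Characteristic functions and their products -/

open scoped Classical in
/-- The characteristic function of the isomorphism classes of the objects of `A`. -/
def charFun (A : ObjectProperty D) : HallFunction D := fun c =>
  if ∃ X, A X ∧ isoClass X = c then 1 else 0

lemma charFun_of_mem {A : ObjectProperty D} {X : D} (hX : A X) : charFun A (isoClass X) = 1 :=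
  if_pos ⟨X, hX, rfl⟩

lemma isoClass_eq_iff {X Y : D} : isoClass X = isoClass Y ↔ Nonempty (X ≅ Y) :=
  Quotient.eq (r := isIsomorphicSetoid D)

lemma exists_of_charFun_ne_zero {A : ObjectProperty D} {c : IsoClass D} (hc : charFun A c ≠ 0) :
    ∃ X, A X ∧ isoClass X = c := by
  by_contra hne
  exact hc (if_neg hne)

lemma charFun_of_not_mem {A : ObjectProperty D} (hA : ∀ X Y, (X ≅ Y) → A X → A Y) {X : D}
    (hX : ¬ A X) : charFun A (isoClass X) = 0 := by
  by_contra hne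
  obtain ⟨Y, hY, hYX⟩ := exists_of_charFun_ne_zero hne
  obtain ⟨e⟩ := isoClass_eq_iff.1 hYX
  exact hX (hA Y X e hY)

lemma charFun_congr {A B : ObjectProperty D} (h : ∀ X, A X ↔ B X) : charFun A = charFun B := by
  rw [show A = B from funext fun X => propext (h X)]

lemma semistableFunction_eq_charFun (σ : StabilityCondition D) (φ : ℝ) :
    semistableFunction σ φ = charFun (σ.P φ) := by
  funext c
  induction c using Quotient.inductionOn with
  | h X =>
    by_cases hX : σ.P φ X
    · exact (if_pos hX).trans (charFun_of_mem hX).symm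
    · exact (if_neg hX).trans (charFun_of_not_mem (σ.iso_mem φ) hX).symm

lemma hallOne_eq_charFun : hallOne D = charFun (IsZero : ObjectProperty D) := by
  classical
  funext c
  induction c using Quotient.inductionOn with
  | h X =>
    change (Pi.single (isoClass (0 : D)) (1 : ℚ) : HallFunction D) (isoClass X) =
      charFun _ (isoClass X)
    by_cases hX : IsZero X
    · rw [show isoClass X = isoClass (0 : D) from isoClass_eq_iff.2 ⟨hX.isoZero⟩, Pi.single_eq_same,
        charFun_of_mem (isZero_zero D)]
    · rw [Pi.single_eq_of_ne, charFun_of_not_mem (fun _ _ e h => h.of_iso e.symm) hX]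
      intro h
      obtain ⟨e⟩ := isoClass_eq_iff.1 h
      exact hX ((isZero_zero D).of_iso e)

/-- If there are no morphisms from nonnegative shifts of objects of `A` to objects of `B`, the
product of the characteristic functions is the characteristic function of the extensions. -/
lemma hasHallProduct_charFun {k : Type w} [Field k] [Finite k] [Linear k D]
    (hfin : IsLeftHomologicallyFinite k D) {A B : ObjectProperty D}
    (hAB : ∀ M N, A M → B N → NoHom M N) :
    HasHallProduct (charFun A) (charFun B) (charFun (star A B)) := by
  intro L
  induction L using Quotient.inductionOn with
  | h L =>
    change (Function.support fun p : IsoClass D × IsoClass D =>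
      charFun A p.1 * charFun B p.2 * hallCoeff p.1 p.2 (isoClass L)).Finite ∧
      ∑ᶠ p : IsoClass D × IsoClass D,
        charFun A p.1 * charFun B p.2 * hallCoeff p.1 p.2 (isoClass L) =
      charFun (star A B) (isoClass L)
    have key : ∀ p : IsoClass D × IsoClass D,
        charFun A p.1 * charFun B p.2 * hallCoeff p.1 p.2 (isoClass L) ≠ 0 →
        ∃ (M N : D) (f : M ⟶ L) (g : L ⟶ N) (h : N ⟶ M⟦(1 : ℤ)⟧), A M ∧ B N ∧
          Triangle.mk f g h ∈ distTriang D ∧ p = (isoClass M, isoClass N) := by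
      rintro ⟨a, b⟩ hp
      obtain ⟨hab, hc⟩ := mul_ne_zero_iff.1 hp
      obtain ⟨ha, hb⟩ := mul_ne_zero_iff.1 hab
      obtain ⟨M, hM, rfl⟩ := exists_of_charFun_ne_zero ha
      obtain ⟨N, hN, rfl⟩ := exists_of_charFun_ne_zero hb
      obtain ⟨f, g, h, hT⟩ := exists_triangle_of_hallNumber_ne_zero hc
      exact ⟨M, N, f, g, h, hM, hN, hT, rfl⟩
    by_cases hL : star A B L
    · rw [charFun_of_mem hL]
      obtain ⟨M, N, f, g, h, hM, hN, hT⟩ := hL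
      -- Any other nonzero term gives a second triangle on `L`, whose outer objects are isomorphic
      -- to `M` and `N`.
      have uniq : ∀ p : IsoClass D × IsoClass D, p ≠ (isoClass M, isoClass N) →
          charFun A p.1 * charFun B p.2 * hallCoeff p.1 p.2 (isoClass L) = 0 := by
        intro p hne
        by_contra hp
        obtain ⟨M', N', f', g', h', hM', hN', hT', rfl⟩ := key p hp
        have h₁ := hAB M' N' hM' hN'
        have h₂ := hAB M' N hM' hN
        have h₃ := hAB M N' hM hN'
        have h₄ := hAB M N hM hN
        obtain ⟨e, -⟩ := NoHom.exists_iso_third hT' hT h₁ h₂ h₃ h₄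
        refine hne (Prod.ext ?_ ?_)
        · exact isoClass_eq_iff.2 (NoHom.nonempty_iso_first hT' hT h₁ h₂ h₃ h₄)
        · exact isoClass_eq_iff.2 ⟨e⟩
      refine ⟨(Set.finite_singleton (isoClass M, isoClass N)).subset fun p hp => ?_, ?_⟩
      · by_contra hne
        exact hp (uniq p hne)
      · rw [finsum_eq_single _ _ uniq, charFun_of_mem hM, charFun_of_mem hN, one_mul, one_mul]
        exact hallNumber_eq_one hfin hT (hAB M N hM hN)
    · have zero : ∀ p : IsoClass D × IsoClass D,
          charFun A p.1 * charFun B p.2 * hallCoeff p.1 p.2 (isoClass L) = 0 := by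
        intro p
        by_contra hp
        obtain ⟨M, N, f, g, h, hM, hN, hT, -⟩ := key p hp
        exact hL ⟨M, N, f, g, h, hM, hN, hT⟩
      rw [charFun_of_not_mem (fun _ _ => star_of_iso) hL, finsum_eq_zero_of_forall_eq_zero zero]
      exact ⟨Set.finite_empty.subset fun p hp => hp (zero p), rfl⟩

/-! ## Objects with Harder-Narasimhan factors of given phases -/

/-- The iterated extensions of objects of `P φ₁`, ..., `P φₙ`, for a list `φ₁, ..., φₙ`. -/
def iteratedStar (P : ℝ → ObjectProperty D) : List ℝ → ObjectProperty D
  | [] => IsZero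
  | φ :: l => star (P φ) (iteratedStar P l)

lemma iteratedStar_of_iso (P : ℝ → ObjectProperty D) (l : List ℝ) (X Y : D) (e : X ≅ Y)
    (hX : iteratedStar P l X) : iteratedStar P l Y := by
  cases l with
  | nil => exact IsZero.of_iso hX e.symm
  | cons φ l => exact star_of_iso e hX

lemma iteratedStar_append [IsTriangulated D] (P : ℝ → ObjectProperty D) (l m : List ℝ) :
    ∀ X, iteratedStar P (l ++ m) X ↔ star (iteratedStar P l) (iteratedStar P m) X := by
  induction l with
  | nil =>
    refine fun X => ⟨star_of_isZero_left (isZero_zero D) (isZero_zero D), fun hX => ?_⟩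
    obtain ⟨N, hN, ⟨e⟩⟩ := exists_iso_of_star_isZero_left (fun _ => id) hX
    exact iteratedStar_of_iso P m N X e hN
  | cons φ l ih =>
    intro X
    refine Iff.trans ?_ (star_assoc _ _ _ X).symm
    exact ⟨star_mono (fun _ => id) fun N => (ih N).1, star_mono (fun _ => id) fun N => (ih N).2⟩

namespace StabilityCondition

variable (σ : StabilityCondition D)

lemma iteratedStar_singleton (φ : ℝ) (X : D) : iteratedStar σ.P [φ] X ↔ σ.P φ X := by
  refine ⟨fun hX => ?_, fun hX => star_of_isZero_right (isZero_zero D) hX (isZero_zero D)⟩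
  obtain ⟨M, hM, ⟨e⟩⟩ := exists_iso_of_star_isZero_right (fun _ => id) hX
  exact σ.iso_mem φ M X e hM

/-- Zero objects lie in every slice and serve as the factors for the additional phases. This makes
the coefficients of the products stabilize. -/
lemma iteratedStar_sublist {l m : List ℝ} (h : l.Sublist m) :
    ∀ X, iteratedStar σ.P l X → iteratedStar σ.P m X := by
  induction h with
  | slnil => exact fun _ => id
  | cons φ _ ih =>
    exact fun X hX => star_of_isZero_left (isZero_zero D) (σ.zero_mem φ _ (isZero_zero D)) (ih X hX)
  | cons_cons φ _ ih => exact fun X => star_mono (fun _ => id) ih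

lemma shift_mem {φ : ℝ} {X : D} (hX : σ.P φ X) (i : ℕ) : σ.P (φ + i) (X⟦(i : ℤ)⟧) := by
  induction i with
  | zero =>
    rw [Nat.cast_zero, add_zero]
    exact σ.iso_mem φ X _ ((shiftFunctorZero' D _ Nat.cast_zero).app X).symm hX
  | succ i ih =>
    rw [Nat.cast_succ, ← add_assoc]
    exact (σ.shift _ _).2 ⟨_, ih,
      ⟨(shiftFunctorAdd' D (i : ℤ) 1 _ (Nat.cast_succ i).symm).app X⟩⟩

lemma noHom {φ ψ : ℝ} (h : ψ < φ) {M N : D} (hM : σ.P φ M) (hN : σ.P ψ N) : NoHom M N :=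
  fun i => σ.hom_eq_zero (φ + i) ψ _ N (by have : (0 : ℝ) ≤ i := i.cast_nonneg; linarith)
    (σ.shift_mem hM i) hN

lemma noHom_iteratedStar {l m : List ℝ} (h : ∀ a ∈ l, ∀ b ∈ m, b < a) :
    ∀ M N : D, iteratedStar σ.P l M → iteratedStar σ.P m N → NoHom M N := by
  induction l with
  | nil => exact fun M N hM _ => noHom_of_isZero_left hM N
  | cons φ l ih =>
    intro M N hM hN
    refine NoHom.star_left (fun M' hM' => ?_)
      (fun M' hM' => ih (fun a ha => h a (List.mem_cons_of_mem φ ha)) M' N hM' hN) M hM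
    have hm : ∀ b ∈ m, b < φ := h φ List.mem_cons_self
    -- `M'` now lies in the single slice of phase `φ`; a second induction, on `m`, decomposes `N`.
    clear ih h hM
    induction m generalizing N with
    | nil => exact noHom_of_isZero_right M' hN
    | cons ψ m ih =>
      exact NoHom.star_right (fun N' hN' => σ.noHom (hm ψ List.mem_cons_self) hM' hN')
        (fun N' hN' => ih N' hN' fun b hb => hm b (List.mem_cons_of_mem ψ hb)) N hN

/-- The characteristic function of the objects all of whose Harder-Narasimhan factors have phases
in a finite set. -/
def partialProd (F : Finset ℝ) : HallFunction D :=
  charFun (iteratedStar σ.P (F.sort (· ≥ ·)))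

/-- The concatenation is already sorted and free of repetitions, and a finite set has only one such
list. -/
lemma sort_union {F G : Finset ℝ} (h : ∀ a ∈ F, ∀ b ∈ G, b < a) :
    (F ∪ G).sort (· ≥ ·) = F.sort (· ≥ ·) ++ G.sort (· ≥ ·) := by
  have hsorted : (F.sort (· ≥ ·) ++ G.sort (· ≥ ·)).Pairwise (· ≥ ·) :=
    List.pairwise_append.2 ⟨F.pairwise_sort _, G.pairwise_sort _, fun a ha b hb =>
      (h a ((Finset.mem_sort _).1 ha) b ((Finset.mem_sort _).1 hb)).le⟩
  have hnodup : (F.sort (· ≥ ·) ++ G.sort (· ≥ ·)).Nodup :=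
    List.nodup_append.2 ⟨F.sort_nodup _, G.sort_nodup _, fun a ha b hb =>
      (h a ((Finset.mem_sort _).1 ha) b ((Finset.mem_sort _).1 hb)).ne'⟩
  have := (List.toFinset_sort (· ≥ ·) hnodup).2 hsorted
  rwa [List.toFinset_append, Finset.sort_toFinset, Finset.sort_toFinset] at this

lemma isDescendingFinProd_partialProd [IsTriangulated D] {k : Type w} [Field k] [Finite k]
    [Linear k D] (hfin : IsLeftHomologicallyFinite k D) :
    IsDescendingFinProd (semistableFunction σ) σ.partialProd where
  empty := by
    rw [partialProd, Finset.sort_empty, hallOne_eq_charFun]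
    rfl
  singleton φ := by
    rw [partialProd, Finset.sort_singleton, semistableFunction_eq_charFun]
    exact charFun_congr (σ.iteratedStar_singleton φ)
  union F G h := by
    rw [partialProd, partialProd, partialProd, sort_union h,
      charFun_congr (iteratedStar_append σ.P _ _)]
    exact hasHallProduct_charFun hfin (σ.noHom_iteratedStar fun a ha b hb =>
      h a ((Finset.mem_sort _).1 ha) b ((Finset.mem_sort _).1 hb))

lemma exists_iteratedStar [IsTriangulated D] {X : D} (hX : HasHNFiltration σ.P X) :
    ∃ l : List ℝ, l.Pairwise (· > ·) ∧ iteratedStar σ.P l X := by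
  obtain ⟨n, E, A, φ, h0, ⟨e⟩, hφ, hE⟩ := hX
  refine ⟨List.ofFn φ, List.pairwise_ofFn.2 fun _ _ hij => hφ hij, ?_⟩
  -- The filtration appends its new factor on the right, whereas `iteratedStar` nests to the right;
  -- `iteratedStar_append` reconciles the two.
  have key : ∀ i : Fin (n + 1), iteratedStar σ.P ((List.ofFn φ).take i) (E i) := by
    intro i
    induction i using Fin.induction with
    | zero => exact h0
    | succ i ih =>
      obtain ⟨hA, f, g, h, hT⟩ := hE i
      have : (List.ofFn φ).take (i.succ : Fin (n + 1)) =
          (List.ofFn φ).take (i.castSucc : Fin (n + 1)) ++ [φ i] := by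
        simp [List.take_add_one]
      rw [this, iteratedStar_append]
      exact ⟨_, _, f, g, h, ih, (σ.iteratedStar_singleton _ _).2 hA, hT⟩
  have := key (Fin.last n)
  rw [List.take_of_length_le (by simp)] at this
  exact iteratedStar_of_iso _ _ _ _ e this

lemma eventually_partialProd_eq_one [IsTriangulated D] (X : D) :
    ∀ᶠ F in atTop, σ.partialProd F (isoClass X) = 1 := by
  obtain ⟨l, hl, hX⟩ : ∃ l : List ℝ, l.Pairwise (· > ·) ∧ iteratedStar σ.P l X := by
    by_cases h : IsZero X
    · exact ⟨[], List.Pairwise.nil, h⟩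
    · exact σ.exists_iteratedStar (σ.filtration X h)
  -- Once `F` contains all the phases in `l`, the strictly decreasing list `l` is a sublist of the
  -- sorted list of `F`.
  refine eventually_atTop.2 ⟨l.toFinset, fun F hF => charFun_of_mem
    (σ.iteratedStar_sublist (List.sublist_of_subperm_of_pairwise (r := (· ≥ ·)) ?_
      (hl.imp le_of_lt) (F.pairwise_sort _)) X hX)⟩
  refine List.subperm_of_subset (hl.imp ne_of_gt) fun a ha => ?_
  exact (Finset.mem_sort _).2 (hF (List.mem_toFinset.2 ha))

end StabilityCondition

end Triangulated

end DerivedHall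

end

theorem mainTheorem1 (k : Type*) [Field k] [Finite k]
    (D : Type*) [Category* D] [HasZeroObject D] [HasShift D ℤ] [Preadditive D]
    [∀ n : ℤ, (shiftFunctor D n).Additive] [Pretriangulated D] [IsTriangulated D]
    [Linear k D] [∀ n : ℤ, (shiftFunctor D n).Linear k]
    (hKS : DerivedHall.IsKrullSchmidt D)
    (hfin : DerivedHall.IsLeftHomologicallyFinite k D)
    (σ : DerivedHall.StabilityCondition D) :
    DerivedHall.HasDescendingProd (DerivedHall.semistableFunction σ) (DerivedHall.allOnes D) := by
  refine ⟨σ.partialProd, σ.isDescendingFinProd_partialProd hfin, fun X => ?_⟩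
  induction X using Quotient.inductionOn with
  | h X => exact σ.eventually_partialProd_eq_one X
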